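/- Let $\mathcal K$ be a field of characteristic zero, let $n\ge 2$, and let $A_n$ be the free associative unital $\mathcal K$-algebra on $n$ generators. Put $[a,b]=ab-ba$, $L_1(A_n)=A_n$, $L_l(A_n)=[A_n,L_{l-1}(A_n)]$ (the linear span of the brackets) for $l\ge 2$, and let $M_l(A_n)=A_n\cdot L_l(A_n)\cdot A_n$ be the two-sided ideal generated by $L_l(A_n)$. Let $k\ge 1$ and let $i=(i_1,\dots,i_k)$ be a tuple of integers with $i_v\ge 2$ for all $v$. Then there is a maximal index $l \ge 1$ such that $M_{i_1}(A_n)\cdots M_{i_k}(A_n)\subseteq M_l(A_n)$; denote it by $\mathrm I(A_n,i)$, so that $M_{i_1}(A_n)\cdots M_{i_k}(A_n)\not\subseteq M_{\mathrm I(A_n,i)+1}(A_n)$. If exactly $p$ of the indices $i_1,\dots,i_k$ are odd, then $$\mathrm I(A_n,(i_1,\dots,i_k))\;\ge\;\sum_{v=1}^k i_v-2k+p+1 .$$ In particular, if all the indices $i_1,\dots,i_k$ are odd, then $$\mathrm I(A_n,(i_1,\dots,i_k))=\sum_{v=1}^k i_v-k+1 .$$ -/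

import Mathlib

namespace LCS

/-- The term `L_l(R)` of the lower central series of the associative algebra `R`:
`L_1(R) = R`, and `L_l(R) = [R, L_{l-1}(R)]` for `l ≥ 2` is the `K`-span of the commutators
`a * b - b * a` with `a ∈ R` and `b ∈ L_{l-1}(R)`. The numbering starts at `1`; the value at `0`
is not used. -/
def L (K R : Type*) [Field K] [Ring R] [Algebra K R] : ℕ → Submodule K R
  | 0 => ⊤
  | 1 => ⊤
  | l + 2 => Submodule.span K {c | ∃ a : R, ∃ b ∈ L K R (l + 1), c = a * b - b * a}

/-- The two-sided ideal `M_l(R) = R ⬝ L_l(R) ⬝ R` generated by `L_l(R)`, as a `K`-subspace. -/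
def M (K R : Type*) [Field K] [Ring R] [Algebra K R] (l : ℕ) : Submodule K R :=
  ⊤ * L K R l * ⊤

/-- The product `M_{i_1}(R) ⋯ M_{i_k}(R)`, taken in the order of the tuple. -/
def prodM (K R : Type*) [Field K] [Ring R] [Algebra K R] {k : ℕ} (i : Fin k → ℕ) :
    Submodule K R :=
  (List.ofFn fun v => M K R (i v)).prod

/-- The indices `l ≥ 1` such that `M_{i_1}(R) ⋯ M_{i_k}(R) ⊆ M_l(R)`. -/
def inclusionIndices (K R : Type*) [Field K] [Ring R] [Algebra K R] {k : ℕ} (i : Fin k → ℕ) :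
    Set ℕ :=
  {l | 1 ≤ l ∧ prodM K R i ≤ M K R l}

/-- `I(R, i)`, the maximal index `l` such that `M_{i_1}(R) ⋯ M_{i_k}(R) ⊆ M_l(R)`. It is meaningful
when this maximum exists. -/
noncomputable def I (K R : Type*) [Field K] [Ring R] [Algebra K R] {k : ℕ} (i : Fin k → ℕ) : ℕ :=
  sSup (inclusionIndices K R i)

end LCS

namespace LCS

universe u

/-! ### Lower bound: products of the ideals `M`. -/

section LowerBound

variable {K R : Type*} [Field K] [Ring R] [Algebra K R]

/-! Below: for odd `j`, `[M_j, R] ⊆ L_{j+1}` (`lie_mem_L_of_mem_M`), hence `[M_j, L_q] ⊆ L_{j+q}`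
and `M_j M_q ⊆ M_{j+q-1}`. Lowering each even index by one and multiplying gives the stated bound.
Above: map the free algebra to a homogenized Weyl algebra, with `[x, y] = z` central and all
commutators divisible by `z`. Then `M_{l+1}` lands in multiples of `z ^ l`, while the product of
ideals attains `z ^ ∑ (i_v - 1)`. The bounds agree when all indices are odd. -/

lemma lie_mem_L_succ {l : ℕ} (hl : 1 ≤ l) (a : R) {b : R} (hb : b ∈ L K R l) :
    ⁅a, b⁆ ∈ L K R (l + 1) := by
  obtain ⟨l, rfl⟩ := Nat.exists_eq_add_of_le' hl
  exact Submodule.subset_span ⟨a, b, hb, rfl⟩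

lemma lie_mem_L_succ' {l : ℕ} (hl : 1 ≤ l) {b : R} (hb : b ∈ L K R l) (a : R) :
    ⁅b, a⁆ ∈ L K R (l + 1) := by
  rw [Ring.lie_def, ← neg_sub]
  exact neg_mem (lie_mem_L_succ hl a hb)

lemma L_succ_induction {l : ℕ} (hl : 1 ≤ l) {N : Submodule K R}
    (h : ∀ a : R, ∀ b ∈ L K R l, ⁅a, b⁆ ∈ N) : L K R (l + 1) ≤ N := by
  obtain ⟨l, rfl⟩ := Nat.exists_eq_add_of_le' hl
  refine Submodule.span_le.2 ?_
  rintro _ ⟨a, b, hb, rfl⟩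
  exact h a b hb

lemma L_succ_le (l : ℕ) : L K R (l + 1) ≤ L K R l := by
  induction l with
  | zero => exact le_top
  | succ l ih =>
    rcases Nat.eq_zero_or_pos l with rfl | hl
    · exact le_top
    · exact L_succ_induction (by omega) fun a b hb => lie_mem_L_succ hl a (ih hb)

lemma L_antitone : Antitone (L K R) := antitone_nat_of_succ_le L_succ_le

lemma M_antitone : Antitone (M K R) := fun _ _ h =>
  mul_le_mul' (mul_le_mul' le_rfl (L_antitone h)) le_rfl

lemma L_le_M (l : ℕ) : L K R l ≤ M K R l := fun x hx => by
  rw [M, ← one_mul x, ← mul_one (1 * x)]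
  exact Submodule.mul_mem_mul
    (Submodule.mul_mem_mul (Submodule.mem_top (R := K) (x := (1 : R))) hx)
    (Submodule.mem_top (R := K) (x := (1 : R)))

lemma M_one : M K R 1 = ⊤ := top_le_iff.1 (L_le_M 1)

lemma top_mul_top : (⊤ : Submodule K R) * ⊤ = ⊤ :=
  top_le_iff.1 fun x _ => by
    simpa using Submodule.mul_mem_mul (Submodule.mem_top (R := K) (x := x))
      (Submodule.mem_top (R := K) (x := (1 : R)))

lemma top_mul_M (l : ℕ) : ⊤ * M K R l = M K R l := by
  rw [M, ← mul_assoc, ← mul_assoc, top_mul_top]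

lemma M_mul_top (l : ℕ) : M K R l * ⊤ = M K R l := by
  rw [M, mul_assoc, top_mul_top]

lemma mul_mem_M_left {l : ℕ} (a : R) {m : R} (hm : m ∈ M K R l) : a * m ∈ M K R l := by
  rw [← top_mul_M]
  exact Submodule.mul_mem_mul Submodule.mem_top hm

lemma mul_mem_M_right {l : ℕ} {m : R} (hm : m ∈ M K R l) (a : R) : m * a ∈ M K R l := by
  rw [← M_mul_top]
  exact Submodule.mul_mem_mul hm Submodule.mem_top

/-- The two-sided ideal generated by `L_l(R)` is already the left ideal generated by it. -/
lemma M_eq_top_mul {l : ℕ} (hl : 1 ≤ l) : M K R l = ⊤ * L K R l := by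
  have h : L K R l * ⊤ ≤ ⊤ * L K R l := by
    refine Submodule.mul_le.2 fun b hb a _ => ?_
    have e : b * a = a * b + 1 * ⁅b, a⁆ := by rw [Ring.lie_def]; noncomm_ring
    rw [e]
    exact add_mem (Submodule.mul_mem_mul Submodule.mem_top hb)
      (Submodule.mul_mem_mul Submodule.mem_top (L_succ_le l (lie_mem_L_succ' hl hb a)))
  refine le_antisymm ?_ ?_
  · calc M K R l = ⊤ * (L K R l * ⊤) := mul_assoc _ _ _
      _ ≤ ⊤ * (⊤ * L K R l) := mul_le_mul' le_rfl h
      _ = ⊤ * L K R l := by rw [← mul_assoc, top_mul_top]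
  · rw [← top_mul_M]
    exact mul_le_mul' le_rfl (L_le_M l)

/-- An expression of `[a[b,[c,x]],e]` through brackets of length four. -/
lemma three_zsmul_lie_mul_lie_lie (a b c e x : R) :
    (3 : ℤ) • ⁅a * ⁅b, ⁅c, x⁆⁆, e⁆ =
        ⁅⁅⁅a * x, c⁆, b⁆, e⁆ - ⁅⁅⁅x * a, c⁆, e⁆, b⁆
        + ⁅⁅⁅x, a⁆, c⁆, e * b⁆ - ⁅⁅⁅x, b⁆, a⁆, c * e⁆
        + ⁅⁅⁅x * b, a⁆, c⁆, e⁆ - ⁅⁅⁅x, e⁆, a * c⁆, b⁆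
        + ⁅⁅⁅x, e⁆, c⁆, b * a⁆ - ⁅⁅⁅x, c⁆, b * e⁆, a⁆
        + (2 : ℤ) • ⁅⁅⁅x, c⁆, b⁆, e * a⁆ + ⁅⁅⁅x, b⁆, e * a⁆, c⁆
        + (2 : ℤ) • ⁅⁅⁅x, e⁆, a⁆, c * b⁆ + ⁅⁅⁅c * x, b⁆, a⁆, e⁆
        + ⁅⁅⁅x, b⁆, e⁆, a * c⁆ - (2 : ℤ) • ⁅⁅⁅a * x, b⁆, e⁆, c⁆
        + (2 : ℤ) • ⁅⁅⁅x, a⁆, b⁆, c * e⁆ - (2 : ℤ) • ⁅⁅⁅x * b, e⁆, a⁆, c⁆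
        - (2 : ℤ) • ⁅⁅⁅x, a⁆, b * c⁆, e⁆ + ⁅⁅⁅x, c⁆, e⁆, a * b⁆
        - ⁅⁅⁅x * e, a⁆, c⁆, b⁆ - ⁅⁅⁅b * x, e⁆, c⁆, a⁆
        - ⁅⁅⁅x * c, b⁆, e⁆, a⁆ - (2 : ℤ) • ⁅⁅⁅e * x, a⁆, b⁆, c⁆
        - ⁅⁅⁅x * e, c⁆, b⁆, a⁆ - ⁅⁅⁅x * c, e⁆, a⁆, b⁆ := by
  simp only [Ring.lie_def]
  noncomm_ring

/-- Every bracket in the identity starts from `x` or a one-sided multiple of it, so `P` only needs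
to hold there. It is used with `P` membership in `M_{2t+1}` and `N = L_{2t+4}`. -/
lemma lie_mul_lie_lie_mem [CharZero K] (N : Submodule K R) (P : R → Prop) {x : R}
    (hx : P x) (hl : ∀ p, P (p * x)) (hr : ∀ p, P (x * p))
    (hN : ∀ y, P y → ∀ p q r : R, ⁅⁅⁅y, p⁆, q⁆, r⁆ ∈ N) (a b c e : R) :
    ⁅a * ⁅b, ⁅c, x⁆⁆, e⁆ ∈ N := by
  have h : (3 : ℤ) • ⁅a * ⁅b, ⁅c, x⁆⁆, e⁆ ∈ N := by
    rw [three_zsmul_lie_mul_lie_lie]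
    repeat' first
      | with_reducible apply hN
      | with_reducible apply sub_mem
      | with_reducible apply add_mem
      | with_reducible apply zsmul_mem
    all_goals first | exact hx | apply hl | apply hr
  have h3 : (3 : K) ≠ 0 := by norm_num
  rw [← Int.cast_smul_eq_zsmul K] at h
  exact (N.smul_mem_iff (by exact_mod_cast h3)).1 h

/-- The index advances by two because `M_{2t+3}` is spanned by the `s[b,[c,x]]` with `x ∈ L_{2t+1}`,
the shape the identity handles; this is where parity enters. -/
lemma lie_mem_L_of_mem_M [CharZero K] (t : ℕ) {m : R} (hm : m ∈ M K R (2 * t + 1)) (a : R) :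
    ⁅m, a⁆ ∈ L K R (2 * t + 2) := by
  induction t generalizing m a with
  | zero => exact lie_mem_L_succ (l := 1) le_rfl m Submodule.mem_top
  | succ t ih =>
    have key : ∀ x ∈ L K R (2 * t + 1), ∀ a b c e : R,
        ⁅a * ⁅b, ⁅c, x⁆⁆, e⁆ ∈ L K R (2 * t + 1 + 1 + 1 + 1) := fun x hx =>
      lie_mul_lie_lie_mem _ (· ∈ M K R (2 * t + 1)) (L_le_M _ hx)
        (fun p => mul_mem_M_left p (L_le_M _ hx)) (fun p => mul_mem_M_right (L_le_M _ hx) p)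
        fun y hy p q r => lie_mem_L_succ' (by omega) (lie_mem_L_succ' (by omega) (ih hy p) q) r
    rw [M_eq_top_mul (by omega)] at hm
    induction hm using Submodule.mul_induction_on' with
    | add x _ y _ hx hy =>
      have e : ⁅x + y, a⁆ = ⁅x, a⁆ + ⁅y, a⁆ := by simp only [Ring.lie_def]; noncomm_ring
      rw [e]
      exact add_mem hx hy
    | mem_mul_mem s _ w hw =>
      let f : R →ₗ[K] R :=
        (LinearMap.mulRight K a - LinearMap.mulLeft K a) ∘ₗ LinearMap.mulLeft K s
      have hf : ∀ w, f w = ⁅s * w, a⁆ := fun w => by simp [f, Ring.lie_def]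
      rw [← hf]
      revert w
      change L K R (2 * t + 1 + 1 + 1) ≤ (L K R (2 * t + 1 + 1 + 1 + 1)).comap f
      refine L_succ_induction (by omega) fun b w hw => ?_
      let g : R →ₗ[K] R := f ∘ₗ (LinearMap.mulLeft K b - LinearMap.mulRight K b)
      have hg : ∀ w, g w = f ⁅b, w⁆ := fun w => by simp [g, Ring.lie_def]
      rw [Submodule.mem_comap, ← hg]
      revert w
      change L K R (2 * t + 1 + 1) ≤ (L K R (2 * t + 1 + 1 + 1 + 1)).comap g
      refine L_succ_induction (by omega) fun c x hx => ?_
      rw [Submodule.mem_comap, hg, hf]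
      exact key x hx s b c a

lemma lie_lie_eq_add (a b c : R) : ⁅a, ⁅b, c⁆⁆ = ⁅⁅a, b⁆, c⁆ + ⁅b, ⁅a, c⁆⁆ := by
  simp only [Ring.lie_def]; noncomm_ring

lemma lie_mem_L_add {p q : ℕ} (hp : 1 ≤ p) (hq : 1 ≤ q) {a b : R} (ha : a ∈ L K R p)
    (hb : b ∈ L K R q) : ⁅a, b⁆ ∈ L K R (p + q) := by
  induction q, hq using Nat.le_induction generalizing p a b with
  | base => exact lie_mem_L_succ' hp ha b
  | succ q hq ih =>
    let f : R →ₗ[K] R := LinearMap.mulLeft K a - LinearMap.mulRight K a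
    have hf : ∀ w, f w = ⁅a, w⁆ := fun w => by simp [f, Ring.lie_def]
    rw [← hf]
    refine L_succ_induction (N := (L K R (p + (q + 1))).comap f) hq (fun c w hw => ?_) hb
    rw [Submodule.mem_comap, hf, lie_lie_eq_add]
    refine add_mem ?_ (lie_mem_L_succ (l := p + q) (by omega) c (ih hp ha hw))
    have := ih (by omega) (lie_mem_L_succ' hp ha c) hw
    rwa [add_assoc, add_comm 1 q] at this

lemma lie_mem_L_add_of_mem_M [CharZero K] (t : ℕ) {q : ℕ} (hq : 1 ≤ q) {m b : R}
    (hm : m ∈ M K R (2 * t + 1)) (hb : b ∈ L K R q) : ⁅m, b⁆ ∈ L K R (2 * t + 1 + q) := by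
  induction q, hq using Nat.le_induction generalizing b with
  | base => exact lie_mem_L_of_mem_M t hm b
  | succ q hq ih =>
    let f : R →ₗ[K] R := LinearMap.mulLeft K m - LinearMap.mulRight K m
    have hf : ∀ w, f w = ⁅m, w⁆ := fun w => by simp [f, Ring.lie_def]
    rw [← hf]
    refine L_succ_induction (N := (L K R (2 * t + 1 + (q + 1))).comap f) hq (fun c w hw => ?_) hb
    -- By Jacobi, the only new term is `[[m,c],w]`, and `[m,c]` already lies in `L_{2t+2}`.
    rw [Submodule.mem_comap, hf, lie_lie_eq_add]
    refine add_mem ?_ (lie_mem_L_succ (l := 2 * t + 1 + q) (by omega) c (ih hw))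
    have := lie_mem_L_add (by omega) hq (lie_mem_L_of_mem_M t hm c) hw
    rwa [show 2 * t + 2 + q = 2 * t + 1 + (q + 1) by ring] at this

lemma M_mul_M_le [CharZero K] (t q : ℕ) :
    M K R (2 * t + 1) * M K R (q + 1) ≤ M K R (2 * t + q + 1) := by
  rcases Nat.eq_zero_or_pos q with rfl | hq
  · rw [zero_add, M_one, M_mul_top, add_zero]
  suffices h : M K R (2 * t + 1) * L K R (q + 1) ≤ M K R (2 * t + q + 1) by
    calc M K R (2 * t + 1) * M K R (q + 1)
        = M K R (2 * t + 1) * ⊤ * L K R (q + 1) * ⊤ := by simp only [M, mul_assoc]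
      _ ≤ M K R (2 * t + q + 1) * ⊤ := by
        rw [M_mul_top]
        exact mul_le_mul' h le_rfl
      _ = _ := M_mul_top _
  refine Submodule.mul_le.2 fun m hm b hb => ?_
  refine L_succ_induction (N := (M K R (2 * t + q + 1)).comap (LinearMap.mulLeft K m)) hq
    (fun a w hw => ?_) hb
  -- Leibniz trades the product for brackets with `m * a` and `m`, both in the ideal `M_{2t+1}`.
  have e : m * ⁅a, w⁆ = ⁅m * a, w⁆ - ⁅m, w⁆ * a := by
    simp only [Ring.lie_def]; noncomm_ring
  rw [Submodule.mem_comap, LinearMap.mulLeft_apply, e, add_right_comm]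
  exact sub_mem (L_le_M _ (lie_mem_L_add_of_mem_M t hq (mul_mem_M_right hm a) hw))
    (mul_mem_M_right (L_le_M _ (lie_mem_L_add_of_mem_M t hq hm hw)) a)

lemma prod_M_le [CharZero K] (s : List ℕ) (hs : ∀ l ∈ s, 1 ≤ l) :
    (s.map (M K R)).prod ≤ M K R ((s.map fun l => 2 * ((l - 1) / 2)).sum + 1) := by
  induction s with
  | nil => simp [M_one]
  | cons l s ih =>
    rw [List.forall_mem_cons] at hs
    rw [List.map_cons, List.prod_cons, List.map_cons, List.sum_cons]
    exact (mul_le_mul' (M_antitone (by omega)) (ih hs.2)).trans (M_mul_M_le _ _)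

end LowerBound

/-! ### Upper bound: a homogenized Weyl algebra. -/

section UpperBound

variable {K R S : Type*} [Field K] [Ring R] [Algebra K R] [Ring S] [Algebra K S]

/-- Since `z` is central, it pulls out of brackets, and each further bracket contributes one more
factor `z`. -/
lemma pow_dvd_of_mem_M {z : S} (hz : ∀ a, Commute z a) (hd : ∀ a b : S, z ∣ ⁅a, b⁆)
    (φ : R →ₐ[K] S) {l : ℕ} {w : R} (hw : w ∈ M K R (l + 1)) : z ^ l ∣ φ w := by
  let D (n : ℕ) : Submodule K R :=
    { carrier := {w | z ^ n ∣ φ w}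
      add_mem' := fun ha hb => by
        rw [Set.mem_ofPred_eq, map_add]; exact dvd_add ha hb
      zero_mem' := by simp
      smul_mem' := fun c a ha => by
        obtain ⟨b, hb⟩ := ha
        exact ⟨c • b, by rw [map_smul, hb, mul_smul_comm]⟩ }
  have hL : ∀ n, L K R (n + 1) ≤ D n := by
    intro n
    induction n with
    | zero => intro w _; change z ^ 0 ∣ φ w; simp
    | succ n ih =>
      refine L_succ_induction (by omega) fun a b hb => ?_
      obtain ⟨c, hc⟩ := ih hb
      obtain ⟨d, hd⟩ := hd (φ a) c
      refine ⟨d, ?_⟩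
      rw [Ring.lie_def] at hd ⊢
      rw [map_sub, map_mul, map_mul, hc, pow_succ, mul_assoc (z ^ n) z d, ← hd, mul_sub,
        ← mul_assoc, ← ((hz (φ a)).pow_left n).eq, mul_assoc, mul_assoc]
  have hM : M K R (l + 1) ≤ D l := by
    rw [M_eq_top_mul (by omega)]
    refine Submodule.mul_le.2 fun a _ b hb => ?_
    obtain ⟨c, hc⟩ := hL l hb
    refine ⟨φ a * c, ?_⟩
    rw [map_mul, hc, ← mul_assoc, ← mul_assoc, ((hz (φ a)).pow_left l).eq]
  exact hM hw

lemma exists_mem_L_map_eq [CharZero K] {z x y : S} (hz : ∀ a, Commute z a) (hxy : ⁅x, y⁆ = z)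
    (φ : R →ₐ[K] S) {u v : R} (hu : φ u = x) (hv : φ v = y) (l m : ℕ) :
    ∃ w ∈ L K R (l + 1), φ w = z ^ l * y ^ m := by
  have hy : ∀ m : ℕ, x * y ^ (m + 1) - y ^ (m + 1) * x = (m + 1 : K) • (z * y ^ m) := by
    intro m
    rw [Ring.lie_def] at hxy
    induction m with
    | zero => simp [hxy]
    | succ m ih =>
      have e : x * y ^ (m + 1 + 1) - y ^ (m + 1 + 1) * x =
          (x * y ^ (m + 1) - y ^ (m + 1) * x) * y + y ^ (m + 1) * (x * y - y * x) := by
        rw [pow_succ y (m + 1)]; noncomm_ring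
      rw [e, ih, hxy, ← (hz _).eq, smul_mul_assoc, mul_assoc, ← pow_succ]
      push_cast
      module
  induction l generalizing m with
  | zero => exact ⟨v ^ m, Submodule.mem_top, by simp [hv]⟩
  | succ l ih =>
    -- Bracketing with `x` lowers the power of `y`: `[x, y^(m+1)] = (m+1) z y^m`, whence the
    -- exponent `m + 1` and the division by `m + 1`.
    obtain ⟨w, hw, e⟩ := ih (m + 1)
    refine ⟨(m + 1 : K)⁻¹ • ⁅u, w⁆, Submodule.smul_mem _ _ (lie_mem_L_succ (by omega) u hw), ?_⟩
    have h0 : (m + 1 : K) ≠ 0 := by exact_mod_cast m.succ_ne_zero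
    rw [map_smul, inv_smul_eq_iff₀ h0, Ring.lie_def, map_sub, map_mul, map_mul, hu, e, pow_succ z,
      mul_assoc (z ^ l) z, ← mul_smul_comm, ← hy, mul_sub, ← mul_assoc, ← mul_assoc, ← mul_assoc,
      ((hz x).pow_left l).eq]

lemma exists_mem_prod_M_map_eq [CharZero K] {z x y : S} (hz : ∀ a, Commute z a)
    (hxy : ⁅x, y⁆ = z) (φ : R →ₐ[K] S) {u v : R} (hu : φ u = x) (hv : φ v = y) (s : List ℕ)
    (hs : ∀ l ∈ s, 1 ≤ l) :
    ∃ w ∈ (s.map (M K R)).prod, φ w = z ^ (s.map fun l => l - 1).sum := by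
  induction s with
  | nil => exact ⟨1, Submodule.one_le.1 le_rfl, by simp⟩
  | cons l s ih =>
    rw [List.forall_mem_cons] at hs
    obtain ⟨w, hw, e⟩ := ih hs.2
    obtain ⟨w', hw', e'⟩ := exists_mem_L_map_eq hz hxy φ hu hv (l - 1) 0
    rw [Nat.sub_add_cancel hs.1] at hw'
    refine ⟨w' * w, ?_, ?_⟩
    · rw [List.map_cons, List.prod_cons]
      exact Submodule.mul_mem_mul (L_le_M _ hw') hw
    · rw [map_mul, e, e', pow_zero, mul_one, List.map_cons, List.sum_cons, pow_add]

/-- The bracket is a derivation in each argument, so divisibility by `z` passes from generators to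
the subalgebra, with quotients staying inside it. -/
lemma exists_lie_eq_smul_of_mem_adjoin {C B : Type*} [CommRing C] [Ring B] [Algebra C B] {z : C}
    {s : Set B} (hs : ∀ a ∈ s, ∀ b ∈ s, ∃ c ∈ Algebra.adjoin C s, ⁅a, b⁆ = z • c) {a b : B}
    (ha : a ∈ Algebra.adjoin C s) (hb : b ∈ Algebra.adjoin C s) :
    ∃ c ∈ Algebra.adjoin C s, ⁅a, b⁆ = z • c := by
  induction ha, hb using Algebra.adjoin_induction₂ with
  | mem_mem a b ha hb => exact hs a ha b hb
  | algebraMap_both r t => exact ⟨0, zero_mem _, by simp [Ring.lie_def, ← map_mul, mul_comm]⟩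
  | algebraMap_left r a ha => exact ⟨0, zero_mem _, by simp [Ring.lie_def, Algebra.commutes]⟩
  | algebraMap_right r a ha => exact ⟨0, zero_mem _, by simp [Ring.lie_def, Algebra.commutes]⟩
  | add_left a b c _ _ _ h h' =>
    obtain ⟨p, hp, e⟩ := h
    obtain ⟨q, hq, e'⟩ := h'
    exact ⟨p + q, add_mem hp hq, by rw [smul_add, ← e, ← e']; simp only [Ring.lie_def]; noncomm_ring⟩
  | add_right a b c _ _ _ h h' =>
    obtain ⟨p, hp, e⟩ := h
    obtain ⟨q, hq, e'⟩ := h'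
    exact ⟨p + q, add_mem hp hq, by rw [smul_add, ← e, ← e']; simp only [Ring.lie_def]; noncomm_ring⟩
  | mul_left a b c ha hb hc h h' =>
    obtain ⟨p, hp, e⟩ := h
    obtain ⟨q, hq, e'⟩ := h'
    refine ⟨a * q + p * b, add_mem (mul_mem ha hq) (mul_mem hp hb), ?_⟩
    rw [smul_add, ← mul_smul_comm, ← smul_mul_assoc, ← e, ← e']
    simp only [Ring.lie_def]; noncomm_ring
  | mul_right a b c ha hb hc h h' =>
    obtain ⟨p, hp, e⟩ := h
    obtain ⟨q, hq, e'⟩ := h'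
    refine ⟨b * q + p * c, add_mem (mul_mem hb hq) (mul_mem hp hc), ?_⟩
    rw [smul_add, ← mul_smul_comm, ← smul_mul_assoc, ← e, ← e']
    simp only [Ring.lie_def]; noncomm_ring

/-- Passing to the subalgebra generated by `x` and `y` is what makes all commutators divisible by
`z`; in `B` itself this may fail. -/
lemma exists_subalgebra_dvd_lie {C B : Type u} [CommRing C] [Ring B] [Algebra C B] {z : C}
    {x y : B} (hxy : ⁅x, y⁆ = z • (1 : B))
    (hN : ∀ (N : ℕ) (b : B), z ^ N • (1 : B) ≠ z ^ (N + 1) • b) :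
    ∃ (S : Type u) (_ : Ring S) (_ : Algebra C S) (x y : S),
      (∀ a b : S, algebraMap C S z ∣ ⁅a, b⁆) ∧ ⁅x, y⁆ = algebraMap C S z ∧
        ∀ N, ¬ algebraMap C S z ^ (N + 1) ∣ algebraMap C S z ^ N := by
  have hx : x ∈ Algebra.adjoin C {x, y} := Algebra.subset_adjoin (by simp)
  have hy : y ∈ Algebra.adjoin C {x, y} := Algebra.subset_adjoin (by simp)
  refine ⟨Algebra.adjoin C {x, y}, inferInstance, inferInstance, ⟨x, hx⟩, ⟨y, hy⟩,
    fun a b => ?_, ?_, ?_⟩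
  · obtain ⟨c, hc, e⟩ := exists_lie_eq_smul_of_mem_adjoin (z := z) (s := {x, y}) (by
      simp only [Set.mem_insert_iff, Set.mem_singleton_iff, forall_eq_or_imp, forall_eq]
      refine ⟨⟨⟨0, zero_mem _, ?_⟩, 1, one_mem _, hxy⟩, ⟨-1, neg_mem (one_mem _), ?_⟩,
        0, zero_mem _, ?_⟩
      · rw [Ring.lie_def, sub_self, smul_zero]
      · rw [smul_neg, ← hxy, Ring.lie_def, Ring.lie_def, neg_sub]
      · rw [Ring.lie_def, sub_self, smul_zero]) a.2 b.2
    refine ⟨⟨c, hc⟩, ?_⟩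
    rw [← Algebra.smul_def]
    exact Subtype.ext e
  · rw [Algebra.algebraMap_eq_smul_one]
    exact Subtype.ext hxy
  · rintro N ⟨s, hs⟩
    rw [← map_pow, ← map_pow, ← Algebra.smul_def, Algebra.algebraMap_eq_smul_one] at hs
    exact hN N s (congrArg Subtype.val hs)

open Polynomial in
/-- The operators `z d/dt` and multiplication by `t` on `K[z][t]` have commutator `z`. -/
lemma exists_end_lie_eq_smul_one (K : Type u) [Field K] :
    ∃ x y : Module.End K[X] K[X][X], ⁅x, y⁆ = (X : K[X]) • (1 : Module.End K[X] K[X][X]) := by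
  refine ⟨(X : K[X]) • derivative, LinearMap.mulLeft K[X] X, LinearMap.ext fun p => ?_⟩
  change (X : K[X]) • derivative (X * p) - X * ((X : K[X]) • derivative p) = (X : K[X]) • p
  rw [derivative_mul, derivative_X]
  simp only [smul_eq_C_mul]
  ring

open Polynomial in
lemma X_pow_smul_one_ne (K : Type u) [Field K] (N : ℕ) (b : Module.End K[X] K[X][X]) :
    (X ^ N : K[X]) • (1 : Module.End K[X] K[X][X]) ≠ (X ^ (N + 1) : K[X]) • b := by
  intro h
  have h1 : (X ^ N : K[X]) • (1 : K[X][X]) = (X ^ (N + 1) : K[X]) • b 1 := LinearMap.congr_fun h 1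
  rw [pow_succ, mul_smul] at h1
  have h2 := smul_right_injective _ (pow_ne_zero N (X_ne_zero (R := K))) h1
  -- After cancelling `z ^ N`, constant terms give `1 = 0`.
  have h0 := congrArg (fun p => (p.coeff 0).coeff 0) h2
  simp at h0

lemma le_of_prod_M_le {K : Type u} [Field K] [CharZero K] {n : ℕ} (hn : 2 ≤ n) (s : List ℕ) (hs : ∀ l ∈ s, 1 ≤ l)
    {N : ℕ} (h : (s.map (M K (FreeAlgebra K (Fin n)))).prod ≤ M K (FreeAlgebra K (Fin n)) N) :
    N ≤ (s.map fun l => l - 1).sum + 1 := by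
  by_contra! hN
  obtain ⟨x, y, hxy⟩ := exists_end_lie_eq_smul_one K
  obtain ⟨S, _, _, x, y, hd, hxy, hne⟩ := exists_subalgebra_dvd_lie hxy (X_pow_smul_one_ne K)
  let _ : Algebra K S := Algebra.compHom S (algebraMap K (Polynomial K))
  have hz := fun a : S => Algebra.commutes (Polynomial.X : Polynomial K) a
  let φ : FreeAlgebra K (Fin n) →ₐ[K] S :=
    FreeAlgebra.lift K fun j => if (j : ℕ) = 0 then x else y
  obtain ⟨w, hw, e⟩ := exists_mem_prod_M_map_eq hz hxy φ
    (u := FreeAlgebra.ι K ⟨0, by omega⟩) (v := FreeAlgebra.ι K ⟨1, by omega⟩)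
    (by simp [φ]) (by simp [φ]) s hs
  exact hne _ (e ▸ pow_dvd_of_mem_M hz hd φ (M_antitone hN (h hw)))

end UpperBound

end LCS

/-! ### Combining the two bounds. -/

theorem mainTheorem11 {K : Type*} [Field K] [CharZero K] (n : ℕ) (hn : 2 ≤ n)
    (k : ℕ) (hk : 1 ≤ k) (i : Fin k → ℕ) (hi : ∀ v, 2 ≤ i v) :
    IsGreatest (LCS.inclusionIndices K (FreeAlgebra K (Fin n)) i)
        (LCS.I K (FreeAlgebra K (Fin n)) i) ∧
      ¬ LCS.prodM K (FreeAlgebra K (Fin n)) i ≤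
          LCS.M K (FreeAlgebra K (Fin n)) (LCS.I K (FreeAlgebra K (Fin n)) i + 1) ∧
      (∀ p : ℕ, (Finset.univ.filter fun v => Odd (i v)).card = p →
        (∑ v, (i v : ℤ)) - 2 * k + p + 1 ≤ (LCS.I K (FreeAlgebra K (Fin n)) i : ℤ)) ∧
      ((∀ v, Odd (i v)) →
        (LCS.I K (FreeAlgebra K (Fin n)) i : ℤ) = (∑ v, (i v : ℤ)) - k + 1) := by
  have hs : ∀ l ∈ List.ofFn i, 1 ≤ l := by
    intro l hl
    obtain ⟨v, rfl⟩ := (List.mem_ofFn' i l).1 hl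
    exact (hi v).trans' (by norm_num)
  have hP : LCS.prodM K (FreeAlgebra K (Fin n)) i =
      ((List.ofFn i).map (LCS.M K (FreeAlgebra K (Fin n)))).prod := by
    rw [List.map_ofFn]; rfl
  have hup : ∀ N, LCS.prodM K (FreeAlgebra K (Fin n)) i ≤ LCS.M K (FreeAlgebra K (Fin n)) N →
      N ≤ ∑ v, (i v - 1) + 1 := by
    intro N hN
    have := LCS.le_of_prod_M_le hn _ hs (hP ▸ hN)
    rwa [List.map_ofFn, List.sum_ofFn] at this
  have hlow := LCS.prod_M_le (K := K) (R := FreeAlgebra K (Fin n)) _ hs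
  rw [← hP, List.map_ofFn, List.sum_ofFn] at hlow
  -- Boundedness and nonemptiness make the `sSup` in `I` a true maximum.
  have hbdd : BddAbove (LCS.inclusionIndices K (FreeAlgebra K (Fin n)) i) :=
    ⟨_, fun N hN => hup N hN.2⟩
  have hmem : LCS.I K (FreeAlgebra K (Fin n)) i ∈
      LCS.inclusionIndices K (FreeAlgebra K (Fin n)) i :=
    Nat.sSup_mem ⟨_, Nat.le_add_left 1 _, hlow⟩ hbdd
  have hle : ∑ v, 2 * ((i v - 1) / 2) + 1 ≤ LCS.I K (FreeAlgebra K (Fin n)) i :=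
    le_csSup hbdd ⟨Nat.le_add_left 1 _, hlow⟩
  have hlower : ∀ p : ℕ, (Finset.univ.filter fun v => Odd (i v)).card = p →
      (∑ v, (i v : ℤ)) - 2 * k + p + 1 ≤ (LCS.I K (FreeAlgebra K (Fin n)) i : ℤ) := by
    rintro p rfl
    -- Each summand on the right is `i v - 1` for odd `i v` and `i v - 2` for even.
    have e : (∑ v, (i v : ℤ)) - 2 * k + (Finset.univ.filter fun v => Odd (i v)).card =
        ((∑ v, 2 * ((i v - 1) / 2) : ℕ) : ℤ) := by
      have h2 : (2 * k : ℤ) = ∑ _v : Fin k, 2 := by simp [mul_comm]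
      rw [h2, Finset.card_filter, Nat.cast_sum, Nat.cast_sum, ← Finset.sum_sub_distrib,
        ← Finset.sum_add_distrib]
      refine Finset.sum_congr rfl fun v _ => ?_
      have := hi v
      split_ifs with h
      · obtain ⟨c, hc⟩ := h
        omega
      · obtain ⟨c, hc⟩ := Nat.not_odd_iff_even.1 h
        omega
    rw [e]
    exact_mod_cast hle
  refine ⟨⟨hmem, fun N hN => le_csSup hbdd hN⟩, fun h => ?_, hlower, fun hodd => ?_⟩
  · exact (Nat.lt_succ_self _).not_ge (le_csSup hbdd ⟨Nat.le_add_left 1 _, h⟩)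
  · have h1 := hlower k (by simp [hodd])
    have h2 := hup _ hmem.2
    have e : ((∑ v, (i v - 1) : ℕ) : ℤ) = (∑ v, (i v : ℤ)) - k := by
      have hk' : (k : ℤ) = ∑ _v : Fin k, 1 := by simp
      rw [hk', Nat.cast_sum, ← Finset.sum_sub_distrib]
      refine Finset.sum_congr rfl fun v _ => ?_
      have := hi v
      omega
    omega
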